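/- Consider one bosonic mode with annihilation operator $a$, $[a,a^\dagger]=1$, and Fock basis $\{|n\rangle\}_{n\ge 0}$. A state is a positive trace-class operator $\rho$ with $\operatorname{Tr}\rho=1$; its characteristic function is $\chi_\rho(\xi)=\operatorname{Tr}\bigl(\rho\,e^{\xi a^\dagger-\xi^* a}\bigr)$, $\xi\in\mathbb C$, and its von Neumann entropy is $S(\rho)=-\operatorname{Tr}(\rho\ln\rho)\in[0,\infty]$. For $\bar n\ge 0$ let $$\rho^{\mathrm{th}}_{\bar n}=\sum_{n\ge 0}\frac{\bar n^{\,n}}{(1+\bar n)^{n+1}}|n\rangle\langle n|,\qquad g(\bar n)=(\bar n+1)\ln(\bar n+1)-\bar n\ln\bar n$$ be the thermal state of mean photon number $\bar n$ and its entropy; $g$ is a bijection of $[0,\infty)$ onto itself. Single-mode gauge-covariant bosonic Gaussian channels are the maps $\Phi$ from states to states given by $$\chi_{\Phi(\rho)}(\xi)=\chi_\rho(\sqrt{\tau}\,\xi)\,e^{-y|\xi|^2/2},\qquad \tau>0,\quad y\ge|\tau-1|,$$ and single-mode gauge-contravariant ones are the maps given by $$\chi_{\Phi(\rho)}(\xi)=\chi_\rho(-\sqrt{|\tau|}\,\xi^*)\,e^{-y|\xi|^2/2},\qquad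 \tau<0,\quad y\ge|\tau-1|.$$ (A state is determined by its characteristic function, so these identities determine $\Phi$.) Say that thermal inputs minimize the output entropy of $\Phi$ if, for every $S_0\in[0,\infty)$ and every state $\rho$ with $S(\rho)=S_0$, $$S(\Phi(\rho))\ \ge\ S\bigl(\Phi(\rho^{\mathrm{th}}_{g^{-1}(S_0)})\bigr).$$ Theorem. If thermal inputs minimize the output entropy of every single-mode gauge-covariant bosonic Gaussian channel, then thermal inputs minimize the output entropy of every single-mode gauge-contravariant bosonic Gaussian channel. -/

import Mathlib

open scoped NNReal ENNReal ComplexConjugate Nat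

noncomputable section

/-- The Hilbert space of one bosonic mode, realised as `ℓ²(ℕ)` through its Fock basis. -/
abbrev ModeSpace : Type := lp (fun _ : ℕ => ℂ) 2

/-- The Fock (photon-number) state `|n⟩`. -/
def fock (n : ℕ) : ModeSpace := lp.single 2 n (1 : ℂ)

/-- A quantum state of the mode: a positive operator of trace one. For a positive operator,
convergence of the sum of its diagonal entries is the trace-class property. -/
structure QState where
  op : ModeSpace →L[ℂ] ModeSpace
  isPositive : op.IsPositive
  hasTrace_one : HasSum (fun n : ℕ => inner ℂ (fock n) (op (fock n))) 1

/-- The operator `-T ln T` of a positive bounded operator `T`, by the continuous functional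
calculus (`Real.negMulLog x = -x ln x`, with value `0` at `x = 0`). -/
def opNegMulLog {E : Type*} [NormedAddCommGroup E] [InnerProductSpace ℂ E] [CompleteSpace E]
    (T : E →L[ℂ] E) : E →L[ℂ] E :=
  cfc Real.negMulLog T

/-- The von Neumann entropy `S(ρ) = -Tr (ρ ln ρ)`, possibly infinite. The diagonal entries are
nonnegative, since `0 ≤ ρ ≤ 1`. -/
def QState.entropy (ρ : QState) : ℝ≥0∞ :=
  ∑' n : ℕ, ENNReal.ofReal (inner ℂ (fock n) (opNegMulLog ρ.op (fock n))).re

/-- Vectors with finitely many photons: the common invariant domain of the creation and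
annihilation operators. `Finsupp.single n 1` stands for `|n⟩`. -/
abbrev FiniteModeSpace : Type := ℕ →₀ ℂ

/-- The inclusion of the finite-photon-number vectors in the Hilbert space. -/
def FiniteModeSpace.toMode : FiniteModeSpace →ₗ[ℂ] ModeSpace :=
  Finsupp.linearCombination ℂ fock

/-- The annihilation operator `a`, with `a |n⟩ = √n |n - 1⟩` and `a |0⟩ = 0`. -/
def annihilation : Module.End ℂ FiniteModeSpace :=
  Finsupp.linearCombination ℂ
    (fun n : ℕ => ((Real.sqrt n : ℝ) : ℂ) • (Finsupp.single (n - 1) 1 : FiniteModeSpace))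

/-- The creation operator `a†`, with `a† |n⟩ = √(n + 1) |n + 1⟩`. -/
def creation : Module.End ℂ FiniteModeSpace :=
  Finsupp.linearCombination ℂ
    (fun n : ℕ => ((Real.sqrt (n + 1 : ℕ) : ℝ) : ℂ) •
      (Finsupp.single (n + 1) 1 : FiniteModeSpace))

/-- The vector `e^{ξ a† - ξ* a} |n⟩`, by the exponential series, which converges in norm on
finite-photon-number vectors. -/
def displacedFock (ξ : ℂ) (n : ℕ) : ModeSpace :=
  ∑' k : ℕ, ((k ! : ℂ))⁻¹ •
    FiniteModeSpace.toMode (((ξ • creation + (-conj ξ) • annihilation) ^ k) (Finsupp.single n 1))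

/-- The characteristic function `χ_ρ(ξ) = Tr (ρ e^{ξ a† - ξ* a})`. -/
def QState.charFun (ρ : QState) (ξ : ℂ) : ℂ :=
  ∑' n : ℕ, inner ℂ (fock n) (ρ.op (displacedFock ξ n))

/-- The gauge-covariant Gaussian channel with parameters `τ > 0` and `y ≥ |τ - 1|`, given by its
action on characteristic functions. A state is determined by its characteristic function, so this
fixes `Φ` completely. -/
def IsGaugeCovariant (τ y : ℝ) (Φ : QState → QState) : Prop :=
  0 < τ ∧ |τ - 1| ≤ y ∧
    ∀ (ρ : QState) (ξ : ℂ), (Φ ρ).charFun ξ =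
      ρ.charFun ((Real.sqrt τ : ℝ) * ξ) * (Real.exp (-y * ‖ξ‖ ^ 2 / 2) : ℝ)

/-- The gauge-contravariant Gaussian channel with parameters `τ < 0` and `y ≥ |τ - 1|`, given by
its action on characteristic functions. -/
def IsGaugeContravariant (τ y : ℝ) (Φ : QState → QState) : Prop :=
  τ < 0 ∧ |τ - 1| ≤ y ∧
    ∀ (ρ : QState) (ξ : ℂ), (Φ ρ).charFun ξ =
      ρ.charFun (-((Real.sqrt |τ| : ℝ) * conj ξ)) * (Real.exp (-y * ‖ξ‖ ^ 2 / 2) : ℝ)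

/-- The weights `n̄ⁿ / (1 + n̄)ⁿ⁺¹` of the Bose-Einstein distribution of mean `n̄`. -/
def thermalWeight (nbar : ℝ≥0) (n : ℕ) : ℝ := (nbar : ℝ) ^ n / (1 + nbar) ^ (n + 1)

theorem thermalWeight_nonneg (nbar : ℝ≥0) (n : ℕ) : 0 ≤ thermalWeight nbar n := by
  unfold thermalWeight; positivity

theorem hasSum_thermalWeight (nbar : ℝ≥0) : HasSum (thermalWeight nbar) 1 := by
  have h0 : (0 : ℝ) ≤ nbar := nbar.2
  have h1 : (0 : ℝ) < 1 + nbar := by positivity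
  have h := (hasSum_geometric_of_lt_one (r := (nbar : ℝ) / (1 + nbar)) (by positivity)
    ((div_lt_one h1).2 (by linarith))).mul_left (1 + (nbar : ℝ))⁻¹
  have e1 : (fun n : ℕ => (1 + (nbar : ℝ))⁻¹ * ((nbar : ℝ) / (1 + nbar)) ^ n)
      = thermalWeight nbar := by
    funext n
    simp only [thermalWeight, div_pow, pow_succ]
    field_simp
  have e2 : (1 + (nbar : ℝ))⁻¹ * (1 - (nbar : ℝ) / (1 + nbar))⁻¹ = 1 := by
    have h2 : 1 - (nbar : ℝ) / (1 + nbar) = (1 + (nbar : ℝ))⁻¹ := by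
      field_simp
      ring
    rw [h2, inv_inv, inv_mul_cancel₀ h1.ne']
  rwa [e1, e2] at h

theorem inner_fock (m n : ℕ) : inner ℂ (fock m) (fock n) = if m = n then (1 : ℂ) else 0 := by
  simp [fock, lp.inner_single_left, lp.single_apply, Pi.single_apply]

theorem norm_fock (n : ℕ) : ‖fock n‖ = 1 := by
  simp [fock, lp.norm_single]

/-- The operator `∑ₙ n̄ⁿ / (1 + n̄)ⁿ⁺¹ |n⟩⟨n|` (a sum convergent in operator norm). -/
def thermalOp (nbar : ℝ≥0) : ModeSpace →L[ℂ] ModeSpace :=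
  ∑' n : ℕ, (thermalWeight nbar n : ℂ) • InnerProductSpace.rankOne ℂ (fock n) (fock n)

theorem summable_thermalOp (nbar : ℝ≥0) : Summable (fun n : ℕ =>
    (thermalWeight nbar n : ℂ) • InnerProductSpace.rankOne ℂ (fock n) (fock n)) := by
  refine Summable.of_norm ?_
  refine (hasSum_thermalWeight nbar).summable.congr fun n => ?_
  rw [norm_smul, InnerProductSpace.norm_rankOne, norm_fock, Complex.norm_real,
    Real.norm_of_nonneg (thermalWeight_nonneg nbar n)]
  simp

theorem thermalOp_apply_fock (nbar : ℝ≥0) (m : ℕ) :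
    thermalOp nbar (fock m) = (thermalWeight nbar m : ℂ) • fock m := by
  have h := (summable_thermalOp nbar).hasSum.mapL
    (ContinuousLinearMap.apply ℂ ModeSpace (fock m))
  refine h.unique ?_
  convert hasSum_single m ?_ using 1
  · simp [norm_fock, -Complex.coe_smul]
  · intro n hn
    simp [inner_fock, hn]

theorem thermalOp_isPositive (nbar : ℝ≥0) : (thermalOp nbar).IsPositive := by
  rw [← ContinuousLinearMap.nonneg_iff_isPositive]
  refine tsum_nonneg fun n => ?_
  rw [ContinuousLinearMap.nonneg_iff_isPositive]
  refine ContinuousLinearMap.IsPositive.smul_of_nonneg ?_ ?_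
  · exact InnerProductSpace.isPositive_rankOne_self _
  · exact_mod_cast thermalWeight_nonneg nbar n

/-- The thermal state of mean photon number `n̄`. -/
def thermalState (nbar : ℝ≥0) : QState where
  op := thermalOp nbar
  isPositive := thermalOp_isPositive nbar
  hasTrace_one := by
    have h := Complex.hasSum_ofReal.2 (hasSum_thermalWeight nbar)
    simpa [thermalOp_apply_fock, inner_smul_right, norm_fock] using h

/-- The function `g(n̄) = (n̄ + 1) ln (n̄ + 1) - n̄ ln n̄`, with `0 ln 0 = 0`: a bijection of
`[0, ∞)` onto itself, and the entropy of the thermal state of mean photon number `n̄`. -/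
def thermalEntropy (nbar : ℝ≥0) : ℝ :=
  (nbar + 1) * Real.log (nbar + 1) - nbar * Real.log nbar

/-- Among the input states of any given finite entropy `S₀`, the thermal state of mean photon
number `n̄ = g⁻¹(S₀)` minimises the output entropy of `Φ`. -/
def ThermalInputMinimizes (Φ : QState → QState) : Prop :=
  ∀ (S₀ : ℝ≥0) (nbar : ℝ≥0), thermalEntropy nbar = S₀ →
    ∀ ρ : QState, ρ.entropy = S₀ → (Φ (thermalState nbar)).entropy ≤ (Φ ρ).entropy

end

/-! Transposition `T` in the Fock basis keeps the spectrum, hence the entropy, fixes the diagonal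
thermal states, and gives `χ_{Tρ}(ξ) = χ_ρ(-ξ*)`. So if `Φ` is contravariant with parameter `τ`,
then `Φ ∘ T` is covariant with parameter `|τ|` and the same `y`. The hypothesis, applied to `Φ ∘ T`
at `Tρ`, is the claim for `Φ` at `ρ`, because `T² = 1`. The analytic work lies in
`QState.charFun_transpose`. On states `T` is entrywise conjugation, so it yields `conj χ_ρ(ξ*)`.
Turning this into `χ_ρ(-ξ*)` needs `D(ξ)† = D(-ξ)` for a bounded `D(ξ)`, and cyclicity of the trace.
-/

noncomputable section

/-! ### Convergence of the exponential series on Fock vectors -/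

/-- The generator `ξ a† - ξ* a` of the displacement `e^{ξ a† - ξ* a}`. -/
def displacementGen (ξ : ℂ) : Module.End ℂ FiniteModeSpace :=
  ξ • creation + (-conj ξ) • annihilation

theorem toMode_single (n : ℕ) : FiniteModeSpace.toMode (Finsupp.single n 1) = fock n := by
  simp [FiniteModeSpace.toMode]

/-- At `n = 0` the truncated `n - 1` is harmless, since its coefficient is `√0`. -/
theorem displacementGen_pow_succ_single (ξ : ℂ) (k n : ℕ) :
    (displacementGen ξ ^ (k + 1)) (Finsupp.single n 1) =
      (ξ * (Real.sqrt (n + 1 : ℕ) : ℝ)) • (displacementGen ξ ^ k) (Finsupp.single (n + 1) 1) -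
      (conj ξ * (Real.sqrt n : ℝ)) • (displacementGen ξ ^ k) (Finsupp.single (n - 1) 1) := by
  rw [pow_succ, Module.End.mul_apply]
  have h : displacementGen ξ (Finsupp.single n 1) =
      (ξ * (Real.sqrt (n + 1 : ℕ) : ℝ)) • Finsupp.single (n + 1) 1 -
      (conj ξ * (Real.sqrt n : ℝ)) • Finsupp.single (n - 1) 1 := by
    simp only [displacementGen, creation, annihilation, LinearMap.add_apply, LinearMap.smul_apply,
      Finsupp.linearCombination_single, smul_smul, sub_eq_add_neg, neg_mul, neg_smul, one_mul]
  rw [h, map_sub, map_smul, map_smul]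

/-- The power expands into `2 ^ k` paths of raising and lowering steps; the heaviest path only
raises and has weight `√((n+1)⋯(n+k))`. -/
theorem norm_toMode_displacementGen_pow_le (ξ : ℂ) (k n : ℕ) :
    ‖FiniteModeSpace.toMode ((displacementGen ξ ^ k) (Finsupp.single n 1))‖ ≤
      (2 * ‖ξ‖) ^ k * Real.sqrt ((n + 1).ascFactorial k : ℕ) := by
  induction k generalizing n with
  | zero => simp [toMode_single, norm_fock]
  | succ k ih =>
    have key : Real.sqrt (n + 1 : ℕ) * Real.sqrt ((n + 2).ascFactorial k : ℕ) =
        Real.sqrt ((n + 1).ascFactorial (k + 1) : ℕ) := by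
      rw [← Real.sqrt_mul (Nat.cast_nonneg _), ← Nat.cast_mul]
      congr 2
      rw [Nat.succ_ascFactorial, Nat.ascFactorial_succ]
    have mono : Real.sqrt n * Real.sqrt ((n - 1 + 1).ascFactorial k : ℕ) ≤
        Real.sqrt ((n + 1).ascFactorial (k + 1) : ℕ) := by
      rw [← key]
      have h : (n - 1 + 1).ascFactorial k ≤ (n + 2).ascFactorial k :=
        Nat.ascFactorial_le k (by omega)
      gcongr
      omega
    rw [displacementGen_pow_succ_single, map_sub, map_smul, map_smul]
    refine (norm_sub_le _ _).trans ?_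
    rw [norm_smul, norm_smul, norm_mul, norm_mul, RCLike.norm_conj, Complex.norm_real,
      Complex.norm_real, Real.norm_of_nonneg (Real.sqrt_nonneg _),
      Real.norm_of_nonneg (Real.sqrt_nonneg _)]
    calc _ ≤ ‖ξ‖ * Real.sqrt (n + 1 : ℕ) *
            ((2 * ‖ξ‖) ^ k * Real.sqrt ((n + 2).ascFactorial k : ℕ)) +
          ‖ξ‖ * Real.sqrt n * ((2 * ‖ξ‖) ^ k * Real.sqrt ((n - 1 + 1).ascFactorial k : ℕ)) := by
          gcongr
          · exact ih (n + 1)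
          · exact ih (n - 1)
      _ = ‖ξ‖ * (2 * ‖ξ‖) ^ k *
            (Real.sqrt (n + 1 : ℕ) * Real.sqrt ((n + 2).ascFactorial k : ℕ)) +
          ‖ξ‖ * (2 * ‖ξ‖) ^ k *
            (Real.sqrt n * Real.sqrt ((n - 1 + 1).ascFactorial k : ℕ)) := by ring
      _ ≤ ‖ξ‖ * (2 * ‖ξ‖) ^ k * Real.sqrt ((n + 1).ascFactorial (k + 1) : ℕ) +
          ‖ξ‖ * (2 * ‖ξ‖) ^ k * Real.sqrt ((n + 1).ascFactorial (k + 1) : ℕ) := by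
          rw [key]; gcongr
      _ = _ := by ring

theorem summable_pow_mul_sqrt_ascFactorial_div_factorial (c : ℝ) (n : ℕ) :
    Summable fun k : ℕ => (k ! : ℝ)⁻¹ * (c ^ k * Real.sqrt ((n + 1).ascFactorial k : ℕ)) := by
  -- The ratio test needs nonzero terms.
  rcases eq_or_ne c 0 with rfl | hc
  · refine summable_of_ne_finset_zero (s := {0}) fun k hk => ?_
    simp_all
  refine summable_of_ratio_test_tendsto_lt_one (l := 0) one_pos ?_ ?_
  · refine Filter.Eventually.of_forall fun k => ?_
    have : 0 < ((n + 1).ascFactorial k : ℝ) := by exact_mod_cast Nat.ascFactorial_pos _ _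
    positivity
  · have h : ∀ k : ℕ, ‖((k + 1) ! : ℝ)⁻¹ *
        (c ^ (k + 1) * Real.sqrt ((n + 1).ascFactorial (k + 1) : ℕ))‖ /
        ‖(k ! : ℝ)⁻¹ * (c ^ k * Real.sqrt ((n + 1).ascFactorial k : ℕ))‖ =
        |c| * Real.sqrt ((n + (k + 1 : ℕ) : ℝ) / (k + 1 : ℕ) * ((k + 1 : ℕ) : ℝ)⁻¹) := by
      intro k
      have h0 : 0 < ((n + 1).ascFactorial k : ℝ) := by exact_mod_cast Nat.ascFactorial_pos _ _
      have h1 : 0 < (k ! : ℝ) := by positivity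
      have h2 : (n + (k + 1 : ℕ) : ℝ) / (k + 1 : ℕ) * ((k + 1 : ℕ) : ℝ)⁻¹ =
          (n + 1 + k : ℕ) / ((k + 1 : ℕ) : ℝ) ^ 2 := by
        push_cast; field_simp; ring
      rw [h2, Real.sqrt_div (Nat.cast_nonneg _), Real.sqrt_sq (Nat.cast_nonneg _),
        Nat.ascFactorial_succ, Nat.cast_mul, Real.sqrt_mul (Nat.cast_nonneg _),
        Nat.factorial_succ, Nat.cast_mul, ← norm_div, pow_succ]
      have h3 := Real.sqrt_pos.2 h0
      have h4 : ((↑(k + 1) * (k ! : ℝ))⁻¹ * (c ^ k * c * (Real.sqrt (n + 1 + k : ℕ) *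
          Real.sqrt ((n + 1).ascFactorial k : ℕ)))) /
          ((k ! : ℝ)⁻¹ * (c ^ k * Real.sqrt ((n + 1).ascFactorial k : ℕ))) =
          c * (Real.sqrt (n + 1 + k : ℕ) / (k + 1 : ℕ)) := by
        have := h3.ne'
        field_simp
      rw [h4, norm_mul, Real.norm_eq_abs, Real.norm_of_nonneg (by positivity)]
    simp_rw [h]
    have t1 : Filter.Tendsto (fun k : ℕ => (n + k : ℝ) / k) Filter.atTop (nhds 1) := by
      have := (tendsto_const_div_atTop_nhds_zero_nat (n : ℝ)).add_const 1
      rw [zero_add] at this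
      refine this.congr' ?_
      filter_upwards [Filter.eventually_gt_atTop 0] with k hk
      have : (k : ℝ) ≠ 0 := by positivity
      field_simp
    have t2 := (t1.mul (tendsto_inv_atTop_nhds_zero_nat (𝕜 := ℝ))).sqrt.const_mul |c|
    simpa using (Filter.tendsto_add_atTop_iff_nat 1).2 t2

/-- The terms of the exponential series defining `displacedFock`. -/
def displacedFockTerm (ξ : ℂ) (n k : ℕ) : ModeSpace :=
  ((k ! : ℂ))⁻¹ • FiniteModeSpace.toMode ((displacementGen ξ ^ k) (Finsupp.single n 1))

theorem summable_norm_displacedFockTerm (ξ : ℂ) (n : ℕ) :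
    Summable fun k => ‖displacedFockTerm ξ n k‖ := by
  refine Summable.of_nonneg_of_le (fun _ => norm_nonneg _) (fun k => ?_)
    (summable_pow_mul_sqrt_ascFactorial_div_factorial (2 * ‖ξ‖) n)
  rw [displacedFockTerm, norm_smul, norm_inv, Complex.norm_natCast]
  gcongr
  exact norm_toMode_displacementGen_pow_le ξ k n

theorem hasSum_displacedFockTerm (ξ : ℂ) (n : ℕ) :
    HasSum (displacedFockTerm ξ n) (displacedFock ξ n) :=
  (summable_norm_displacedFockTerm ξ n).of_norm.hasSum

/-! ### Displacement operators and their adjoints -/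

theorem inner_toMode_creation (u v : FiniteModeSpace) :
    inner ℂ (creation u).toMode v.toMode = inner ℂ u.toMode (annihilation v).toMode := by
  induction u using Finsupp.induction_linear with
  | zero => simp
  | add u₁ u₂ h₁ h₂ => simp only [map_add, inner_add_left, h₁, h₂]
  | single m c =>
    induction v using Finsupp.induction_linear with
    | zero => simp
    | add v₁ v₂ h₁ h₂ => simp only [map_add, inner_add_right, h₁, h₂]
    | single n d =>
      simp only [creation, annihilation, FiniteModeSpace.toMode, Finsupp.linearCombination_single,
        map_smul, inner_smul_left, inner_smul_right, one_smul, inner_fock, Complex.conj_ofReal]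
      rcases n with _ | n
      · simp
      · by_cases h : m = n
        · simp [h, mul_comm]
        · simp [h]

theorem inner_toMode_displacementGen (ξ : ℂ) (u v : FiniteModeSpace) :
    inner ℂ (displacementGen ξ u).toMode v.toMode =
      inner ℂ u.toMode (displacementGen (-ξ) v).toMode := by
  have h : inner ℂ (annihilation u).toMode v.toMode = inner ℂ u.toMode (creation v).toMode := by
    rw [← inner_conj_symm, ← inner_toMode_creation, inner_conj_symm]
  simp only [displacementGen, LinearMap.add_apply, LinearMap.smul_apply, map_add, map_smul,
    inner_add_left, inner_add_right, inner_smul_left, inner_smul_right, inner_toMode_creation, h]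
  simp
  ring

theorem inner_toMode_displacementGen_pow (ξ : ℂ) (k : ℕ) (u v : FiniteModeSpace) :
    inner ℂ ((displacementGen ξ ^ k) u).toMode v.toMode =
      inner ℂ u.toMode ((displacementGen (-ξ) ^ k) v).toMode := by
  induction k generalizing v with
  | zero => simp
  | succ k ih =>
    rw [pow_succ', Module.End.mul_apply, inner_toMode_displacementGen, ih, pow_succ,
      Module.End.mul_apply]

theorem inner_displacedFock_left (ξ : ℂ) (m n : ℕ) :
    inner ℂ (displacedFock ξ m) (fock n) = inner ℂ (fock m) (displacedFock (-ξ) n) := by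
  have h₁ := (hasSum_displacedFockTerm ξ m).mapL (innerSL ℂ (fock n))
  have h₁' := h₁.map (starRingEnd ℂ) Complex.continuous_conj
  have h₂ := (hasSum_displacedFockTerm (-ξ) n).mapL (innerSL ℂ (fock m))
  simp only [innerSL_apply_apply, inner_conj_symm, Function.comp_def] at h₁' h₂
  refine h₁'.unique (h₂.congr_fun ?_)
  intro k
  simp only [displacedFockTerm, inner_smul_left, inner_smul_right, ← toMode_single,
    inner_toMode_displacementGen_pow]
  simp

theorem displacementGen_neg (ξ : ℂ) : displacementGen (-ξ) = (-1 : ℂ) • displacementGen ξ := by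
  rw [displacementGen, displacementGen, map_neg]; module

/-- The Cauchy product of the two exponential series, grouped by total degree `N`. The generator is
skew-adjoint, so degree `N` carries the factor `(-1 + 1) ^ N / N!` and only `N = 0` survives. -/
theorem inner_displacedFock_displacedFock (ξ : ℂ) (m n : ℕ) :
    inner ℂ (displacedFock ξ m) (displacedFock ξ n) = if m = n then (1 : ℂ) else 0 := by
  set u := displacedFockTerm ξ m
  set v := displacedFockTerm ξ n
  have hs : Summable fun p : ℕ × ℕ => (inner ℂ (u p.1) (v p.2) : ℂ) := by
    refine Summable.of_norm_bounded ((summable_norm_displacedFockTerm ξ m).mul_of_nonneg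
      (summable_norm_displacedFockTerm ξ n) (fun _ => norm_nonneg _) (fun _ => norm_nonneg _)) ?_
    exact fun p => norm_inner_le_norm _ _
  have hsum : HasSum (fun p : ℕ × ℕ => (inner ℂ (u p.1) (v p.2) : ℂ))
      (inner ℂ (displacedFock ξ m) (displacedFock ξ n)) := by
    have h₂ (j : ℕ) : HasSum (fun k => (inner ℂ (u j) (v k) : ℂ))
        (inner ℂ (u j) (displacedFock ξ n)) := by
      simpa using (hasSum_displacedFockTerm ξ n).mapL (innerSL ℂ (u j))
    have h₁ : HasSum (fun j => (inner ℂ (u j) (displacedFock ξ n) : ℂ))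
        (inner ℂ (displacedFock ξ m) (displacedFock ξ n)) := by
      have := ((hasSum_displacedFockTerm ξ m).mapL
        (innerSL ℂ (displacedFock ξ n))).map (starRingEnd ℂ) Complex.continuous_conj
      simpa only [innerSL_apply_apply, inner_conj_symm, Function.comp_def] using this
    rw [← (hs.hasSum.prod_fiberwise h₂).unique h₁]
    exact hs.hasSum
  have hsig := ((Finset.HasAntidiagonal.sigmaAntidiagonalEquivProd.hasSum_iff).2 hsum).sigma
    fun N => hasSum_fintype _
  have hterm (N : ℕ) : ∑ p : Finset.HasAntidiagonal.antidiagonal N,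
      (inner ℂ (u (p : ℕ × ℕ).1) (v (p : ℕ × ℕ).2) : ℂ)
      = (0 ^ N * (N ! : ℂ)⁻¹) *
        inner ℂ (fock m) ((displacementGen ξ ^ N) (Finsupp.single n 1)).toMode := by
    rw [Finset.sum_coe_sort (Finset.HasAntidiagonal.antidiagonal N)
      (fun p => (inner ℂ (u p.1) (v p.2) : ℂ))]
    have hz := (Commute.all (-1 : ℂ) 1).add_pow' N
    rw [neg_add_cancel] at hz
    rw [hz, Finset.sum_mul, Finset.sum_mul]
    refine Finset.sum_congr rfl fun p hp => ?_
    rw [Finset.HasAntidiagonal.mem_antidiagonal] at hp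
    subst hp
    have hc : ((p.1 + p.2).choose p.1 : ℂ) * ((p.1 + p.2) ! : ℂ)⁻¹ =
        (p.1 ! : ℂ)⁻¹ * (p.2 ! : ℂ)⁻¹ := by
      have h := Nat.add_choose_mul_factorial_mul_factorial p.1 p.2
      have h0 : (p.1 ! : ℂ) ≠ 0 := by exact_mod_cast p.1.factorial_ne_zero
      have h1 : (p.2 ! : ℂ) ≠ 0 := by exact_mod_cast p.2.factorial_ne_zero
      have h2 : ((p.1 + p.2)! : ℂ) ≠ 0 := by exact_mod_cast (p.1 + p.2).factorial_ne_zero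
      field_simp
      rw [Nat.choose_symm_add]
      norm_cast
    simp only [u, v, displacedFockTerm, inner_smul_left, inner_smul_right,
      inner_toMode_displacementGen_pow, displacementGen_neg, smul_pow, LinearMap.smul_apply,
      map_smul, ← toMode_single, ← Module.End.mul_apply, ← pow_add, nsmul_eq_mul, one_pow, mul_one]
    rw [show ∀ a b c d : ℂ, a * b * c * d = (a * c) * (b * d) by intros; ring, hc]
    simp
    ring
  refine hsig.unique ?_
  refine HasSum.congr_fun (f := fun N => (0 ^ N * (N ! : ℂ)⁻¹) *
    inner ℂ (fock m) ((displacementGen ξ ^ N) (Finsupp.single n 1)).toMode) ?_ hterm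
  convert hasSum_single 0 fun N hN => ?_ using 1
  · simp [toMode_single, inner_fock]
  · simp [hN]

theorem orthonormal_displacedFock (ξ : ℂ) : Orthonormal ℂ (displacedFock ξ) :=
  orthonormal_iff_ite.2 (inner_displacedFock_displacedFock ξ)

/-- The displacement operator `D(ξ) = e^{ξ a† - ξ* a}`, a linear isometry of the mode space. -/
def displacement (ξ : ℂ) : ModeSpace →L[ℂ] ModeSpace :=
  (orthonormal_displacedFock ξ).orthogonalFamily.linearIsometry.toContinuousLinearMap

theorem displacement_fock (ξ : ℂ) (n : ℕ) : displacement ξ (fock n) = displacedFock ξ n := by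
  have := (orthonormal_displacedFock ξ).orthogonalFamily.linearIsometry_apply_single (i := n) 1
  rw [LinearIsometry.toSpanSingleton_apply, one_smul] at this
  exact this

theorem ext_inner_fock {x y : ModeSpace}
    (h : ∀ n, inner ℂ (fock n) x = inner ℂ (fock n) y) : x = y := by
  refine lp.ext (funext fun n => ?_)
  simpa [fock, lp.inner_single_left] using h n

theorem adjoint_displacement_fock (ξ : ℂ) (n : ℕ) :
    (displacement ξ).adjoint (fock n) = displacedFock (-ξ) n := by
  refine ext_inner_fock fun m => ?_
  rw [ContinuousLinearMap.adjoint_inner_right, displacement_fock, inner_displacedFock_left]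

/-! ### Functional calculus -/

/-- Stated over `ℝ` because entrywise conjugation of operators is only real-linear. -/
theorem map_opNegMulLog {E : Type*} [NormedAddCommGroup E] [InnerProductSpace ℂ E]
    [CompleteSpace E] (F : (E →L[ℂ] E) →⋆ₐ[ℝ] (E →L[ℂ] E)) (hF : Continuous F) {A : E →L[ℂ] E}
    (hA : IsSelfAdjoint A) : F (opNegMulLog A) = opNegMulLog (F A) :=
  F.map_cfc Real.negMulLog A Real.continuous_negMulLog.continuousOn hF hA (hA.map F)

theorem ContinuousLinearMap.IsPositive.exists_isSelfAdjoint_mul_self {E : Type*}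
    [NormedAddCommGroup E] [InnerProductSpace ℂ E] [CompleteSpace E] {A : E →L[ℂ] E}
    (hA : A.IsPositive) : ∃ R : E →L[ℂ] E, IsSelfAdjoint R ∧ R * R = A :=
  ⟨CFC.sqrt A, (CFC.sqrt_nonneg A).isSelfAdjoint,
    CFC.sqrt_mul_sqrt_self A ((ContinuousLinearMap.nonneg_iff_isPositive A).2 hA)⟩

/-! ### Transposition of states -/

/-- Complex conjugation with respect to the Fock basis. -/
def modeConj : ModeSpace ≃ₗᵢ⋆[ℂ] ModeSpace := starₗᵢ ℂ

theorem modeConj_modeConj (x : ModeSpace) : modeConj (modeConj x) = x := star_star x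

theorem modeConj_fock (n : ℕ) : modeConj (fock n) = fock n := by
  refine lp.ext (funext fun m => ?_)
  change star ((fock n : ModeSpace) m) = fock n m
  by_cases h : m = n
  · subst h; simp [fock]
  · simp [fock, lp.single_apply, h]

theorem inner_modeConj_modeConj (x y : ModeSpace) :
    inner ℂ (modeConj x) (modeConj y) = conj (inner ℂ x y : ℂ) := by
  rw [lp.inner_eq_tsum, lp.inner_eq_tsum, Complex.conj_tsum]
  refine tsum_congr fun n => ?_
  change inner ℂ (star (x n)) (star (y n)) = _
  simp

theorem inner_modeConj_left (x y : ModeSpace) :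
    inner ℂ (modeConj x) y = conj (inner ℂ x (modeConj y) : ℂ) := by
  rw [← inner_modeConj_modeConj, modeConj_modeConj]

theorem inner_modeConj_right (x y : ModeSpace) :
    inner ℂ x (modeConj y) = conj (inner ℂ (modeConj x) y : ℂ) := by
  rw [← inner_modeConj_modeConj, modeConj_modeConj]

/-- The entrywise complex conjugate of an operator in the Fock basis. -/
def conjOp (A : ModeSpace →L[ℂ] ModeSpace) : ModeSpace →L[ℂ] ModeSpace :=
  (modeConj.toContinuousLinearEquiv : ModeSpace →L⋆[ℂ] ModeSpace).comp
    (A.comp (modeConj.toContinuousLinearEquiv : ModeSpace →L⋆[ℂ] ModeSpace))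

theorem conjOp_apply (A : ModeSpace →L[ℂ] ModeSpace) (x : ModeSpace) :
    conjOp A x = modeConj (A (modeConj x)) := rfl

theorem conjOp_conjOp (A : ModeSpace →L[ℂ] ModeSpace) : conjOp (conjOp A) = A := by
  ext1 x
  simp only [conjOp_apply, modeConj_modeConj]

/-- Entrywise complex conjugation as a real star-algebra endomorphism. -/
def conjOpHom : (ModeSpace →L[ℂ] ModeSpace) →⋆ₐ[ℝ] (ModeSpace →L[ℂ] ModeSpace) where
  toFun := conjOp
  map_one' := by ext1 x; exact modeConj_modeConj x
  map_mul' A B := by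
    ext1 x
    simp only [mul_apply_eq_comp, conjOp_apply, modeConj_modeConj]
  map_zero' := by ext1 x; exact map_zero modeConj
  map_add' A B := by
    ext1 x
    simp only [add_apply, conjOp_apply, map_add]
  commutes' r := by
    ext1 x
    simp only [Algebra.algebraMap_eq_smul_one, conjOp_apply, smul_apply,
      one_apply_eq_self]
    change modeConj ((r : ℂ) • modeConj x) = (r : ℂ) • x
    rw [modeConj.map_smulₛₗ, modeConj_modeConj,
      Complex.conj_ofReal]
  map_star' A := by
    rw [ContinuousLinearMap.star_eq_adjoint, ContinuousLinearMap.star_eq_adjoint,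
      ContinuousLinearMap.eq_adjoint_iff]
    intro x y
    rw [conjOp_apply, conjOp_apply, inner_modeConj_left, ContinuousLinearMap.adjoint_inner_left,
      inner_modeConj_right x]

theorem norm_conjOp_le (A : ModeSpace →L[ℂ] ModeSpace) : ‖conjOp A‖ ≤ ‖A‖ := by
  refine ContinuousLinearMap.opNorm_le_bound _ (norm_nonneg _) fun x => ?_
  rw [conjOp_apply, LinearIsometryEquiv.norm_map]
  simpa using A.le_opNorm (modeConj x)

theorem continuous_conjOpHom : Continuous conjOpHom :=
  AddMonoidHomClass.continuous_of_bound conjOpHom 1 fun A => by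
    rw [one_mul]; exact norm_conjOp_le A

theorem conjOp_opNegMulLog (A : ModeSpace →L[ℂ] ModeSpace) (hA : IsSelfAdjoint A) :
    conjOp (opNegMulLog A) = opNegMulLog (conjOp A) :=
  map_opNegMulLog conjOpHom continuous_conjOpHom hA

theorem inner_fock_conjOp (A : ModeSpace →L[ℂ] ModeSpace) (m n : ℕ) :
    inner ℂ (fock m) (conjOp A (fock n)) = conj (inner ℂ (fock m) (A (fock n)) : ℂ) := by
  rw [conjOp_apply, modeConj_fock, inner_modeConj_right, modeConj_fock]

/-- The transpose of a state in the Fock basis; by self-adjointness, its complex conjugate. -/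
def QState.transpose (ρ : QState) : QState where
  op := conjOp ρ.op
  isPositive := by
    rw [ContinuousLinearMap.isPositive_iff']
    refine ⟨ρ.isPositive.isSelfAdjoint.map conjOpHom, fun x => ?_⟩
    rw [conjOp_apply, inner_modeConj_left, inner_conj_symm]
    exact ρ.isPositive.inner_nonneg_right _
  hasTrace_one := by
    simp only [inner_fock_conjOp]
    simpa only [map_one, Function.comp_def] using ρ.hasTrace_one.map (starRingEnd ℂ) Complex.continuous_conj

theorem QState.ext_op {ρ σ : QState} (h : ρ.op = σ.op) : ρ = σ := by
  cases ρ; cases σ; simp_all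

theorem QState.transpose_transpose (ρ : QState) : ρ.transpose.transpose = ρ :=
  QState.ext_op (conjOp_conjOp ρ.op)

theorem QState.entropy_transpose (ρ : QState) : ρ.transpose.entropy = ρ.entropy := by
  refine tsum_congr fun n => ?_
  rw [QState.transpose, ← conjOp_opNegMulLog _ ρ.isPositive.isSelfAdjoint, inner_fock_conjOp,
    Complex.conj_re]

theorem ContinuousLinearMap.ext_fock {A B : ModeSpace →L[ℂ] ModeSpace}
    (h : ∀ n, A (fock n) = B (fock n)) : A = B := by
  refine lp.ext_continuousLinearMap (by simp) fun n => ?_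
  refine ContinuousLinearMap.ext_ring ?_
  exact h n

theorem transpose_thermalState (nbar : ℝ≥0) :
    (thermalState nbar).transpose = thermalState nbar := by
  refine QState.ext_op (ContinuousLinearMap.ext_fock fun n => ?_)
  change conjOp (thermalOp nbar) (fock n) = thermalOp nbar (fock n)
  rw [conjOp_apply, modeConj_fock, thermalOp_apply_fock, modeConj.map_smulₛₗ, modeConj_fock,
    Complex.conj_ofReal]

/-- Both `a` and `a†` have real Fock matrices, so conjugation acts only on `ξ`. -/
theorem modeConj_toMode_displacementGen_pow (ξ : ℂ) (k n : ℕ) :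
    modeConj ((displacementGen ξ ^ k) (Finsupp.single n 1)).toMode =
      ((displacementGen (conj ξ) ^ k) (Finsupp.single n 1)).toMode := by
  induction k generalizing n with
  | zero => simp [toMode_single, modeConj_fock]
  | succ k ih =>
    simp only [displacementGen_pow_succ_single, map_sub, map_smul, modeConj.map_smulₛₗ, ih,
      map_mul, Complex.conj_ofReal]

theorem modeConj_displacedFock (ξ : ℂ) (n : ℕ) :
    modeConj (displacedFock ξ n) = displacedFock (conj ξ) n := by
  refine ((hasSum_displacedFockTerm ξ n).map modeConj modeConj.continuous).unique
    ((hasSum_displacedFockTerm (conj ξ) n).congr_fun fun k => ?_)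
  simp only [Function.comp_apply, displacedFockTerm, modeConj.map_smulₛₗ,
    modeConj_toMode_displacementGen_pow, map_inv₀, map_natCast]

/-! ### Hilbert–Schmidt operators and cyclicity of the trace -/

theorem hasSum_norm_sq_inner_fock (x : ModeSpace) :
    HasSum (fun n => ‖(inner ℂ (fock n) x : ℂ)‖ ^ 2) (‖x‖ ^ 2) := by
  have h := lp.hasSum_norm (p := 2) (by norm_num) x
  simpa [fock, lp.inner_single_left] using h

/-- An operator is Hilbert–Schmidt if the squared norms of its columns are summable. -/
def IsHilbertSchmidt (A : ModeSpace →L[ℂ] ModeSpace) : Prop :=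
  Summable fun n => ‖A (fock n)‖ ^ 2

theorem IsHilbertSchmidt.summable_entries {A : ModeSpace →L[ℂ] ModeSpace}
    (hA : IsHilbertSchmidt A) :
    Summable fun p : ℕ × ℕ => ‖(inner ℂ (fock p.2) (A (fock p.1)) : ℂ)‖ ^ 2 := by
  refine (summable_prod_of_nonneg fun _ => by positivity).2 ⟨fun n => ?_, ?_⟩
  · exact (hasSum_norm_sq_inner_fock (A (fock n))).summable
  · exact hA.congr fun n => (hasSum_norm_sq_inner_fock (A (fock n))).tsum_eq.symm

/-- Summing the squared matrix entries by rows or by columns gives the same total. -/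
theorem IsHilbertSchmidt.adjoint {A : ModeSpace →L[ℂ] ModeSpace} (hA : IsHilbertSchmidt A) :
    IsHilbertSchmidt A.adjoint := by
  have h := ((summable_prod_of_nonneg fun _ => by positivity).1
    (hA.summable_entries.prod_symm)).2
  refine h.congr fun n => ?_
  rw [← (hasSum_norm_sq_inner_fock (A.adjoint (fock n))).tsum_eq]
  refine tsum_congr fun m => ?_
  rw [ContinuousLinearMap.adjoint_inner_right, ← inner_conj_symm, RCLike.norm_conj]
  rfl

theorem IsHilbertSchmidt.mul_left {A : ModeSpace →L[ℂ] ModeSpace} (hA : IsHilbertSchmidt A)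
    (B : ModeSpace →L[ℂ] ModeSpace) : IsHilbertSchmidt (B * A) := by
  refine Summable.of_nonneg_of_le (fun _ => by positivity) (fun n => ?_)
    (Summable.mul_left (‖B‖ ^ 2) hA)
  rw [← mul_pow]
  gcongr
  exact B.le_opNorm _

theorem IsHilbertSchmidt.mul_right {A : ModeSpace →L[ℂ] ModeSpace} (hA : IsHilbertSchmidt A)
    (B : ModeSpace →L[ℂ] ModeSpace) : IsHilbertSchmidt (A * B) := by
  have h := (hA.adjoint.mul_left B.adjoint).adjoint
  simpa only [← ContinuousLinearMap.star_eq_adjoint, ← star_mul, star_star] using h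

theorem hasSum_inner_fock_mul (x y : ModeSpace) :
    HasSum (fun n => (inner ℂ x (fock n) : ℂ) * inner ℂ (fock n) y) (inner ℂ x y) := by
  have h := lp.hasSum_inner (𝕜 := ℂ) x y
  simpa [fock, lp.inner_single_left, lp.inner_single_right, mul_comm] using h

/-- Cyclicity of the trace for Hilbert–Schmidt operators. -/
theorem IsHilbertSchmidt.trace_mul_comm {A B : ModeSpace →L[ℂ] ModeSpace}
    (hA : IsHilbertSchmidt A) (hB : IsHilbertSchmidt B) :
    ∑' n, (inner ℂ (fock n) ((A * B) (fock n)) : ℂ) =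
      ∑' n, (inner ℂ (fock n) ((B * A) (fock n)) : ℂ) := by
  have expand (A B : ModeSpace →L[ℂ] ModeSpace) (n : ℕ) :
      (inner ℂ (fock n) ((A * B) (fock n)) : ℂ) =
        ∑' m, inner ℂ (fock n) (A (fock m)) * inner ℂ (fock m) (B (fock n)) := by
    rw [mul_apply_eq_comp, ← ContinuousLinearMap.adjoint_inner_left,
      ← (hasSum_inner_fock_mul _ _).tsum_eq]
    simp only [ContinuousLinearMap.adjoint_inner_left]
  -- The bound `|ab| ≤ |a|² + |b|²` gives the absolute summability that permits exchanging the two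
  -- sums.
  have hs : Summable fun p : ℕ × ℕ =>
      (inner ℂ (fock p.1) (A (fock p.2)) : ℂ) * inner ℂ (fock p.2) (B (fock p.1)) := by
    refine Summable.of_norm_bounded (hA.summable_entries.prod_symm.add hB.summable_entries)
      fun p => ?_
    rw [norm_mul]
    change _ ≤ ‖(inner ℂ (fock p.1) (A (fock p.2)) : ℂ)‖ ^ 2 + _
    nlinarith [sq_nonneg (‖(inner ℂ (fock p.1) (A (fock p.2)) : ℂ)‖ -
      ‖(inner ℂ (fock p.2) (B (fock p.1)) : ℂ)‖),
      sq_nonneg (‖(inner ℂ (fock p.1) (A (fock p.2)) : ℂ)‖),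
      sq_nonneg (‖(inner ℂ (fock p.2) (B (fock p.1)) : ℂ)‖)]
  rw [tsum_congr (expand A B), tsum_congr (expand B A)]
  refine (Summable.tsum_comm (f := fun n m => (inner ℂ (fock n) (A (fock m)) : ℂ) *
    inner ℂ (fock m) (B (fock n))) hs).symm.trans ?_
  exact tsum_congr fun m => tsum_congr fun n => mul_comm _ _

/-- The squared column norms of `R` are the diagonal entries of `ρ`. -/
theorem QState.isHilbertSchmidt_of_mul_self_eq (ρ : QState) {R : ModeSpace →L[ℂ] ModeSpace}
    (hR : IsSelfAdjoint R) (hRR : R * R = ρ.op) : IsHilbertSchmidt R := by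
  refine (Complex.hasSum_re ρ.hasTrace_one).summable.congr fun n => ?_
  rw [← hRR, mul_apply_eq_comp, ← ContinuousLinearMap.adjoint_inner_left, hR.adjoint_eq,
    ← inner_self_eq_norm_sq (𝕜 := ℂ)]
  rfl

/-- Cyclicity of the trace for the product of a state and a bounded operator. -/
theorem QState.trace_mul_comm (ρ : QState) (B : ModeSpace →L[ℂ] ModeSpace) :
    ∑' n, (inner ℂ (fock n) ((ρ.op * B) (fock n)) : ℂ) =
      ∑' n, (inner ℂ (fock n) ((B * ρ.op) (fock n)) : ℂ) := by
  obtain ⟨R, hsa, hRR⟩ := ρ.isPositive.exists_isSelfAdjoint_mul_self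
  have hR := ρ.isHilbertSchmidt_of_mul_self_eq hsa hRR
  -- Two Hilbert–Schmidt swaps: `R(RB) → (RB)R = R(BR) → (BR)R`.
  rw [← hRR, mul_assoc, hR.trace_mul_comm (hR.mul_right B), mul_assoc,
    hR.trace_mul_comm (hR.mul_left B), mul_assoc]

/-! ### Characteristic functions under transposition -/

/-- Conjugating `Tr(ρD)` gives `Tr(D†ρ)`, which cyclicity turns into `Tr(ρD†)` with `D(ξ)† = D(-ξ)`.
-/
theorem QState.conj_charFun (ρ : QState) (ξ : ℂ) : conj (ρ.charFun ξ) = ρ.charFun (-ξ) := by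
  have h := ρ.trace_mul_comm (displacement ξ).adjoint
  simp only [mul_apply_eq_comp, adjoint_displacement_fock,
    ContinuousLinearMap.adjoint_inner_right, displacement_fock] at h
  rw [QState.charFun, QState.charFun, h, Complex.conj_tsum]
  refine tsum_congr fun n => ?_
  rw [inner_conj_symm, ← ContinuousLinearMap.adjoint_inner_right,
    ρ.isPositive.isSelfAdjoint.adjoint_eq]

theorem QState.charFun_transpose (ρ : QState) (ξ : ℂ) :
    ρ.transpose.charFun ξ = ρ.charFun (-conj ξ) := by
  rw [← QState.conj_charFun, QState.charFun, QState.charFun, Complex.conj_tsum]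
  refine tsum_congr fun n => ?_
  change inner ℂ (fock n) (conjOp ρ.op (displacedFock ξ n)) = _
  rw [conjOp_apply, inner_modeConj_right, modeConj_fock, modeConj_displacedFock]

/-- A gauge-contravariant channel preceded by transposition is gauge-covariant. -/
theorem IsGaugeContravariant.comp_transpose {τ y : ℝ} {Φ : QState → QState}
    (hΦ : IsGaugeContravariant τ y Φ) :
    IsGaugeCovariant |τ| y fun ρ => Φ ρ.transpose := by
  obtain ⟨hτ, hy, h⟩ := hΦ
  refine ⟨abs_pos.2 hτ.ne, le_trans ?_ hy, fun ρ ξ => ?_⟩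
  -- For `τ < 0` one has `|τ - 1| = |τ| + 1`, which dominates `||τ| - 1|`.
  · rw [abs_of_neg hτ, abs_of_neg (by linarith : τ - 1 < 0), abs_le]
    constructor <;> linarith
  · rw [h, QState.charFun_transpose]
    simp

end

theorem mainTheorem1
    (hcov : ∀ (τ y : ℝ) (Φ : QState → QState), IsGaugeCovariant τ y Φ → ThermalInputMinimizes Φ) :
    ∀ (τ y : ℝ) (Φ : QState → QState), IsGaugeContravariant τ y Φ → ThermalInputMinimizes Φ := by
  intro τ y Φ hΦ S₀ nbar hn ρ hρ
  have h := hcov _ y _ hΦ.comp_transpose S₀ nbar hn ρ.transpose (by rw [ρ.entropy_transpose, hρ])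
  simpa only [transpose_thermalState, QState.transpose_transpose] using h
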